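/- Let $N=2$, $Q=I_2$ and $B=\begin{pmatrix}-1&1\\-1&-1\end{pmatrix}$. For $t\in(0,+\infty]$ let $Q_t=\int_0^t e^{sB}Qe^{sB^*}\,ds$, and let $\gamma_t$ be the centered Gaussian probability measure on $\mathbb{R}^2$ with density $(2\pi)^{-1}(\det Q_t)^{-1/2}e^{-\frac12\langle Q_t^{-1}x,x\rangle}$. Let $\mathcal H_tf(x)=\int f(e^{tB}x-y)\,d\gamma_t(y)$, $t>0$, be the Ornstein–Uhlenbeck semigroup, acting on the complex Hilbert space $L^2(\gamma_\infty)$, and let $\mathcal L$ be its infinitesimal generator in $L^2(\gamma_\infty)$: $u$ is in the domain of $\mathcal L$ and $\mathcal Lu=v$ exactly when $(\mathcal H_tu-u)/t\to v$ in $L^2(\gamma_\infty)$ as $t\to0^+$ (on Schwartz functions, $\mathcal Lf(x)=\frac12\Delta f(x)+\langle Bx,\nabla f(x)\rangle$). For $\mu\in\mathbb{C}$, a nonzero $u\in L^2(\gamma_\infty)$ is called an eigenfunction of $\mathcal L$ with eigenvalue $\mu$ if $\mathcal Lu=\mu u$, and a generalized eigenfunction of $\mathcal L$ with eigenvalue $\mu$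 if $(\mathcal L-\mu I)^ku=0$ for some integer $k\ge1$ (where $(\mathcal L-\mu I)^k$ has its natural domain). Then the eigenvalues of $B$ are exactly $-1\pm i$; every generalized eigenfunction of $\mathcal L$ with eigenvalue $\mu$ is an eigenfunction of $\mathcal L$ with eigenvalue $\mu$; and any two eigenfunctions of $\mathcal L$ with different eigenvalues are orthogonal in $L^2(\gamma_\infty)$. -/

import Mathlib

open MeasureTheory Filter Topology

noncomputable section

namespace OrnsteinUhlenbeck

variable {N : ℕ}

/-- The covariance matrix `Q_t = ∫_0^t e^{sB} Q e^{sB^*} ds` (entrywise integral), for a time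
`t ∈ (0, +∞]`. -/
def covMatrix (Q B : Matrix (Fin N) (Fin N) ℝ) (t : EReal) : Matrix (Fin N) (Fin N) ℝ :=
  Matrix.of fun i j =>
    ∫ s in {s : ℝ | 0 < s ∧ (s : EReal) ≤ t},
      (NormedSpace.exp (s • B) * Q * NormedSpace.exp (s • B.transpose)) i j

/-- The normalized Gaussian measure `γ_t`, `t ∈ (0, +∞]`, with density
`(2π)^{-N/2} (det Q_t)^{-1/2} exp (-⟨Q_t⁻¹ x, x⟩ / 2)` with respect to Lebesgue measure. -/
def gaussian (Q B : Matrix (Fin N) (Fin N) ℝ) (t : EReal) :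
    Measure (EuclideanSpace ℝ (Fin N)) :=
  volume.withDensity fun x => ENNReal.ofReal
    ((2 * Real.pi) ^ (-(N : ℝ) / 2) * (covMatrix Q B t).det ^ (-(1 : ℝ) / 2) *
      Real.exp (-(1 / 2) * inner ℝ (Matrix.toEuclideanCLM (𝕜 := ℝ) (covMatrix Q B t)⁻¹ x) x))

/-- The invariant measure `γ_∞`. -/
abbrev gaussianInfty (Q B : Matrix (Fin N) (Fin N) ℝ) : Measure (EuclideanSpace ℝ (Fin N)) :=
  gaussian Q B ⊤

/-- The complex Hilbert space `L²(γ_∞)`. -/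
abbrev L2 (Q B : Matrix (Fin N) (Fin N) ℝ) : Type :=
  Lp ℂ 2 (gaussianInfty Q B)

/-- The Ornstein--Uhlenbeck semigroup, by the Kolmogorov formula
`H_t f (x) = ∫ f (e^{tB} x - y) dγ_t(y)`, `t > 0`. -/
def semigroup (Q B : Matrix (Fin N) (Fin N) ℝ) (t : ℝ)
    (f : EuclideanSpace ℝ (Fin N) → ℂ) (x : EuclideanSpace ℝ (Fin N)) : ℂ :=
  ∫ y, f (Matrix.toEuclideanCLM (𝕜 := ℝ) (NormedSpace.exp (t • B)) x - y)
    ∂(gaussian Q B (t : EReal))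

/-- The graph of the Ornstein--Uhlenbeck operator `L`, the infinitesimal generator of the semigroup
in `L²(γ_∞)`: `IsGenerator Q B u v` says that `u` is in the domain of `L` and `L u = v`, that is,
`(H_t u - u) / t → v` in `L²(γ_∞)` as `t → 0+`. -/
def IsGenerator (Q B : Matrix (Fin N) (Fin N) ℝ) (u v : L2 Q B) : Prop :=
  Tendsto
    (fun t : ℝ => eLpNorm (fun x => (t : ℂ)⁻¹ * (semigroup Q B t u x - u x) - v x) 2
      (gaussianInfty Q B))
    (𝓝[>] 0) (𝓝 0)

/-- The graph of `(L - μ I)^k` with its natural domain: `u` is in the domain and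
`(L - μ I)^k u = w`. -/
def IsShiftPow (Q B : Matrix (Fin N) (Fin N) ℝ) (μ : ℂ) : ℕ → L2 Q B → L2 Q B → Prop
  | 0, u, w => w = u
  | k + 1, u, w => ∃ v : L2 Q B, IsGenerator Q B u v ∧ IsShiftPow Q B μ k (v - μ • u) w

/-- `u` is an eigenfunction of `L` with eigenvalue `μ`. -/
def IsEigenfunction (Q B : Matrix (Fin N) (Fin N) ℝ) (μ : ℂ) (u : L2 Q B) : Prop :=
  u ≠ 0 ∧ IsGenerator Q B u (μ • u)

/-- `u` is a generalized eigenfunction of `L` with generalized eigenvalue `μ`: `u ≠ 0` and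
`(L - μ I)^k u = 0` for some positive integer `k`. -/
def IsGeneralizedEigenfunction (Q B : Matrix (Fin N) (Fin N) ℝ) (μ : ℂ) (u : L2 Q B) : Prop :=
  u ≠ 0 ∧ ∃ k : ℕ, 0 < k ∧ IsShiftPow Q B μ k u 0

/-- The drift matrix of the example. -/
def exampleB : Matrix (Fin 2) (Fin 2) ℝ :=
  !![-1, 1; -1, -1]

end OrnsteinUhlenbeck

end

namespace OrnsteinUhlenbeck

/-! Write B = -I + J with J skew. Then e^{tB} is e^{-t} times a rotation R, and every Q_t is a
scalar matrix. Hence H_t is composition with R after a symmetric Ornstein–Uhlenbeck operator S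
commuting with it, so H_t is normal on L²(γ_∞) (`exists_isStarNormal_markov`). Normality passes to
D_t = (H_t - 1)/t - μ. If Lv = μv then ‖D_t* v‖ = ‖D_t v‖ → 0, whence ⟨v, Lu⟩ = μ⟨v, u⟩ for every u
in the domain (`inner_generator_eq`). An eigenfunction u with another eigenvalue is therefore
orthogonal to v. Moreover, if w = (L - μ)u is killed by L - μ, the identity gives ⟨w, w⟩ = 0, so no
Jordan chains exist. -/

open ContinuousLinearMap in
/-- A generator-type eigenvector for a family of normal operators is a weak eigenvector of the
adjoint. -/
theorem inner_generator_eq {H : Type*} [NormedAddCommGroup H] [InnerProductSpace ℂ H]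
    [CompleteSpace H] {T : ℝ → H →L[ℂ] H} (hT : ∀ t, 0 < t → IsStarNormal (T t))
    {μ : ℂ} {u v w : H}
    (hv : Tendsto (fun t : ℝ => (t : ℂ)⁻¹ • (T t v - v)) (𝓝[>] 0) (𝓝 (μ • v)))
    (hu : Tendsto (fun t : ℝ => (t : ℂ)⁻¹ • (T t u - u)) (𝓝[>] 0) (𝓝 w)) :
    inner ℂ v w = μ * inner ℂ v u := by
  set D : ℝ → H →L[ℂ] H := fun t => (t : ℂ)⁻¹ • (T t - 1) - μ • (1 : H →L[ℂ] H) with hD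
  have hDn : ∀ t, 0 < t → IsStarNormal (D t) := by
    intro t ht
    have h := (hT t ht).star_comm_self
    refine ⟨?_⟩
    have h1 : Commute (star (T t)) (1 : H →L[ℂ] H) := Commute.one_right _
    have hone : ∀ S : H →L[ℂ] H, Commute 1 S := Commute.one_left
    have hone' : ∀ S : H →L[ℂ] H, Commute S 1 := Commute.one_right
    simp only [hD, star_sub, star_smul, star_one]
    refine Commute.sub_left (Commute.smul_left ?_ _) (Commute.smul_left (hone _) _)
    refine Commute.sub_left ?_ (hone _)
    exact Commute.sub_right (Commute.smul_right (Commute.sub_right h (hone' _)) _)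
      (Commute.smul_right (hone' _) _)
  have hDv : Tendsto (fun t => ‖D t v‖) (𝓝[>] 0) (𝓝 0) := by
    have := (hv.sub_const (μ • v)).norm
    simpa [hD] using this
  have hDv' : Tendsto (fun t => adjoint (D t) v) (𝓝[>] 0) (𝓝 0) := by
    rw [tendsto_zero_iff_norm_tendsto_zero]
    refine hDv.congr' ?_
    filter_upwards [self_mem_nhdsWithin] with t ht
    -- The only use of normality: `D t` and its adjoint have equal norms on each vector.
    exact isStarNormal_iff_norm_eq_adjoint.mp (hDn t ht) v
  have hDu : Tendsto (fun t => D t u) (𝓝[>] 0) (𝓝 (w - μ • u)) := by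
    simpa [hD] using hu.sub_const (μ • u)
  have e1 : Tendsto (fun t => inner ℂ v (D t u)) (𝓝[>] 0) (𝓝 (inner ℂ v (w - μ • u))) :=
    tendsto_const_nhds.inner hDu
  have e2 : Tendsto (fun t => inner ℂ v (D t u)) (𝓝[>] 0) (𝓝 0) := by
    have : Tendsto (fun t => inner ℂ (adjoint (D t) v) u) (𝓝[>] 0) (𝓝 (inner ℂ (0 : H) u)) :=
      hDv'.inner tendsto_const_nhds
    simpa [adjoint_inner_left] using this
  have := tendsto_nhds_unique e1 e2
  rw [inner_sub_right, inner_smul_right] at this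
  exact sub_eq_zero.mp this

/-! ### Composition operators and normal Markov operators -/

section Koopman

variable {X Y Z : Type*} [MeasurableSpace X] [MeasurableSpace Y] [MeasurableSpace Z]
  {μ : Measure X} {ν : Measure Y} {ρ : Measure Z}

/-- The composition operator on `L²` of a measure preserving map. -/
noncomputable def koopman (f : X → Y) (hf : MeasurePreserving f μ ν) :
    Lp ℂ 2 ν →L[ℂ] Lp ℂ 2 μ :=
  (Lp.compMeasurePreservingₗᵢ ℂ f hf).toContinuousLinearMap

theorem koopman_coeFn (f : X → Y) (hf : MeasurePreserving f μ ν) (u : Lp ℂ 2 ν) :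
    koopman f hf u =ᵐ[μ] u ∘ f :=
  Lp.coeFn_compMeasurePreserving u hf

theorem koopman_comp {f : X → Y} (hf : MeasurePreserving f μ ν) {g : Y → Z}
    (hg : MeasurePreserving g ν ρ) :
    koopman f hf ∘L koopman g hg = koopman (g ∘ f) (hg.comp hf) := by
  ext1 u
  exact (Lp.compMeasurePreserving_comp_apply u hg hf).symm

theorem koopman_congr {f g : X → Y} {hf : MeasurePreserving f μ ν}
    (hg : MeasurePreserving g μ ν) (h : f = g) : koopman f hf = koopman g hg := by
  subst h; rfl

theorem koopman_id : koopman id (MeasurePreserving.id μ) = 1 := by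
  ext1 u
  exact Lp.compMeasurePreserving_id_apply u

/-- Composition with `f` is an isometry, and composition with `g` is a right inverse of it; an
isometry with a right inverse is unitary. -/
theorem adjoint_koopman {f : X → Y} {g : Y → X} (hf : MeasurePreserving f μ ν)
    (hg : MeasurePreserving g ν μ) (h' : g ∘ f = id) :
    ContinuousLinearMap.adjoint (koopman f hf) = koopman g hg := by
  have h1 : koopman f hf ∘L koopman g hg = 1 := by
    rw [koopman_comp, koopman_congr (.id _) h', koopman_id]
  have h2 : ContinuousLinearMap.adjoint (koopman f hf) ∘L koopman f hf = 1 :=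
    ContinuousLinearMap.norm_map_iff_adjoint_comp_self _ |>.mp fun u =>
      (Lp.compMeasurePreservingₗᵢ ℂ f hf).norm_map u
  calc ContinuousLinearMap.adjoint (koopman f hf)
      = ContinuousLinearMap.adjoint (koopman f hf) ∘L (koopman f hf ∘L koopman g hg) := by
        rw [h1]; ext1; simp
    _ = koopman g hg := by
        rw [← ContinuousLinearMap.comp_assoc, h2]; ext1; simp

variable [IsProbabilityMeasure μ] [IsProbabilityMeasure ν]

/-- The adjoint of `u ↦ u ∘ fst` integrates out the second variable. -/
theorem adjoint_koopman_fst (F : Lp ℂ 2 (μ.prod ν)) :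
    ContinuousLinearMap.adjoint (koopman Prod.fst (measurePreserving_fst (μ := μ) (ν := ν))) F
      =ᵐ[μ] fun x => ∫ y, F (x, y) ∂ν := by
  set E := koopman Prod.fst (measurePreserving_fst (μ := μ) (ν := ν))
  have hF : Integrable F (μ.prod ν) := (Lp.memLp F).integrable one_le_two
  -- Test against the indicator of `A`: the adjoint moves it to the indicator of `A ×ˢ univ`, and
  -- Fubini concludes.
  refine Integrable.ae_eq_of_forall_setIntegral_eq _ _ ((Lp.memLp _).integrable one_le_two)
    hF.integral_prod_left fun A hA _ => ?_
  rw [← L2.inner_indicatorConstLp_one hA (measure_ne_top μ A),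
    ContinuousLinearMap.adjoint_inner_right]
  have : E (indicatorConstLp 2 hA (measure_ne_top μ A) (1 : ℂ)) =
      indicatorConstLp 2 (measurable_fst hA) (measure_ne_top (μ.prod ν) _) (1 : ℂ) :=
    Lp.indicatorConstLp_compMeasurePreserving hA (measure_ne_top μ A) 1 _
  rw [this, L2.inner_indicatorConstLp_one]
  have hpre : (Prod.fst ⁻¹' A : Set (X × Y)) = A ×ˢ Set.univ := by ext; simp
  rw [hpre, setIntegral_prod F hF.integrableOn]
  simp

/-- A Markov operator built from a measure preserving involution of a product space is self-adjoint;
twisted by a commuting symmetry it is normal. -/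
theorem exists_isStarNormal_markov {φ : X × Y → X × Y}
    (hφ : MeasurePreserving φ (μ.prod ν) (μ.prod ν)) (hφφ : φ ∘ φ = id)
    {R R' : X → X} (hR : MeasurePreserving R μ μ) (hR' : MeasurePreserving R' μ μ)
    (hRR' : R ∘ R' = id) (hR'R : R' ∘ R = id)
    {P P' : Y → Y} (hP : MeasurePreserving P ν ν) (hP' : MeasurePreserving P' ν ν)
    (hPP' : P ∘ P' = id)
    (hcomm : φ ∘ Prod.map R P = Prod.map R P ∘ φ) :
    ∃ T : Lp ℂ 2 μ →L[ℂ] Lp ℂ 2 μ, IsStarNormal T ∧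
      ∀ u : Lp ℂ 2 μ, T u =ᵐ[μ] fun x => ∫ y, u (φ (R x, y)).1 ∂ν := by
  set E := koopman Prod.fst (measurePreserving_fst (μ := μ) (ν := ν)) with hE
  set Φ := koopman φ hφ
  set U := koopman R hR with hU
  set U' := koopman R' hR'
  set V := koopman (Prod.map R P) (hR.prod hP)
  set V' := koopman (Prod.map R' P') (hR'.prod hP')
  set E' := ContinuousLinearMap.adjoint E with hE'
  have hΦ : ContinuousLinearMap.adjoint Φ = Φ := adjoint_koopman hφ hφ hφφ
  have hUa : ContinuousLinearMap.adjoint U = U' := adjoint_koopman hR hR' hR'R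
  have hVa' : ContinuousLinearMap.adjoint V' = V :=
    adjoint_koopman (hR'.prod hP') (hR.prod hP)
      (by rw [Prod.map_comp_map, hRR', hPP', Prod.map_id])
  have hUa' : ContinuousLinearMap.adjoint U' = U := adjoint_koopman hR' hR hRR'
  have hVE : V ∘L E = E ∘L U := by
    rw [koopman_comp, koopman_comp]; rfl
  have hVE' : V' ∘L E = E ∘L U' := by
    rw [koopman_comp, koopman_comp]; rfl
  -- Taking adjoints turns symmetries into their inverses, so the relation for `V'` and `U'` is the
  -- one to dualize.
  have hEV : E' ∘L V = U ∘L E' := by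
    have := congrArg ContinuousLinearMap.adjoint hVE'
    rwa [ContinuousLinearMap.adjoint_comp, ContinuousLinearMap.adjoint_comp, hVa', hUa'] at this
  have hVΦ : V ∘L Φ = Φ ∘L V := by
    rw [koopman_comp, koopman_comp, koopman_congr _ hcomm]
  have hUU' : U * U' = 1 := by
    change U ∘L U' = 1
    rw [koopman_comp, koopman_congr (.id _) hR'R, koopman_id]
  have hU'U : U' * U = 1 := by
    change U' ∘L U = 1
    rw [koopman_comp, koopman_congr (.id _) hRR', koopman_id]
  -- Self-adjoint because `Φ` comes from an involution and is compressed by `E`. The normal operator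
  -- will be `U * S`, a unitary times a commuting self-adjoint.
  set S : Lp ℂ 2 μ →L[ℂ] Lp ℂ 2 μ := E' ∘L (Φ ∘L E) with hS
  have hSa : star S = S := by
    rw [ContinuousLinearMap.star_eq_adjoint, hS, ContinuousLinearMap.adjoint_comp,
      ContinuousLinearMap.adjoint_comp, hΦ, hE', ContinuousLinearMap.adjoint_adjoint,
      ContinuousLinearMap.comp_assoc]
  have hUS : U * S = S * U := by
    change U ∘L (E' ∘L (Φ ∘L E)) = (E' ∘L (Φ ∘L E)) ∘L U
    simp only [ContinuousLinearMap.comp_assoc]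
    rw [← hVE, ← ContinuousLinearMap.comp_assoc Φ, ← hVΦ, ← ContinuousLinearMap.comp_assoc U,
      ← hEV]
    simp only [ContinuousLinearMap.comp_assoc]
  have hUs : star U = U' := hUa
  refine ⟨U * S, ⟨?_⟩, fun u => ?_⟩
  · change star (U * S) * (U * S) = (U * S) * star (U * S)
    rw [star_mul, hSa, hUs]
    have hSU' : S * U' = U' * S := by
      calc S * U' = U' * U * (S * U') := by rw [hU'U, one_mul]
        _ = U' * (U * S) * U' := by simp only [mul_assoc]
        _ = U' * S * (U * U') := by rw [hUS]; simp only [mul_assoc]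
        _ = U' * S := by rw [hUU', mul_one]
    calc S * U' * (U * S) = S * (U' * U) * S := by simp only [mul_assoc]
      _ = S * (U * U') * S := by rw [hU'U, hUU']
      _ = S * U * (U' * S) := by simp only [mul_assoc]
      _ = U * S * (S * U') := by rw [← hUS, hSU']
  · have h1 : S u =ᵐ[μ] fun x => ∫ y, u (φ (x, y)).1 ∂ν := by
      refine (adjoint_koopman_fst (Φ (E u))).trans ?_
      have h2 : Φ (E u) =ᵐ[μ.prod ν] fun z => u (φ z).1 :=
        (koopman_coeFn φ hφ (E u)).trans
          (hφ.quasiMeasurePreserving.ae_eq_comp (koopman_coeFn _ _ u))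
      filter_upwards [Measure.ae_ae_of_ae_prod h2] with x hx
      exact integral_congr_ae hx
    exact (koopman_coeFn R hR (S u)).trans (hR.quasiMeasurePreserving.ae_eq_comp h1)

end Koopman

/-! ### Isotropic Gaussians and time reversal -/

section Gaussian

/-- The density of the centered isotropic Gaussian measure on the plane with covariance `c I`. -/
noncomputable def isoDensity (c : ℝ) (x : EuclideanSpace ℝ (Fin 2)) : ℝ :=
  (2 * Real.pi * c)⁻¹ * Real.exp (-(2 * c)⁻¹ * ‖x‖ ^ 2)

/-- The centered isotropic Gaussian measure on the plane with covariance `c I`. -/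
noncomputable def isoGaussian (c : ℝ) : Measure (EuclideanSpace ℝ (Fin 2)) :=
  volume.withDensity fun x => ENNReal.ofReal (isoDensity c x)

theorem measurable_ofReal_isoDensity (c : ℝ) :
    Measurable fun x => ENNReal.ofReal (isoDensity c x) := by
  unfold isoDensity
  fun_prop

theorem isProbabilityMeasure_isoGaussian {c : ℝ} (hc : 0 < c) :
    IsProbabilityMeasure (isoGaussian c) := by
  have hb : 0 < (2 * c)⁻¹ := by positivity
  have hint := GaussianFourier.integral_rexp_neg_mul_sq_norm (V := EuclideanSpace ℝ (Fin 2)) hb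
  have hpi := Real.pi_pos
  have hone : ∫ x, isoDensity c x = 1 := by
    simp only [isoDensity]
    rw [integral_const_mul, hint]
    simp
    field_simp
  refine ⟨?_⟩
  rw [isoGaussian, withDensity_apply _ MeasurableSet.univ, Measure.restrict_univ,
    ← ofReal_integral_eq_lintegral_ofReal, hone, ENNReal.ofReal_one]
  · exact Integrable.of_integral_ne_zero (by rw [hone]; exact one_ne_zero)
  · refine Eventually.of_forall fun x => ?_
    simp only [isoDensity, Pi.zero_apply]
    positivity

theorem measurePreserving_withDensity {X : Type*} [MeasurableSpace X] {μ : Measure X}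
    {f : X → X} (hf : MeasurePreserving f μ μ) {g : X → ENNReal} (hg : Measurable g)
    (hgf : ∀ x, g (f x) = g x) :
    MeasurePreserving f (μ.withDensity g) (μ.withDensity g) := by
  refine ⟨hf.measurable, ?_⟩
  ext s hs
  rw [Measure.map_apply hf.measurable hs, withDensity_apply _ hs,
    withDensity_apply _ (hf.measurable hs), ← hf.setLIntegral_comp_preimage hs hg]
  simp only [hgf]

theorem measurePreserving_isoGaussian (c : ℝ)
    (R : EuclideanSpace ℝ (Fin 2) ≃ₗᵢ[ℝ] EuclideanSpace ℝ (Fin 2)) :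
    MeasurePreserving R (isoGaussian c) (isoGaussian c) :=
  measurePreserving_withDensity R.measurePreserving (measurable_ofReal_isoDensity c)
    fun x => by simp [isoDensity]

/-- The linear involution of the product space exchanging the two time marginals of the stationary
Ornstein--Uhlenbeck process. -/
def reversal (E : Type*) [AddCommGroup E] [Module ℝ E] (a : ℝ) : E × E →ₗ[ℝ] E × E where
  toFun z := (a • z.1 - z.2, -((1 - a ^ 2) • z.1) - a • z.2)
  map_add' x y := by ext <;> simp <;> module
  map_smul' r x := by ext <;> simp <;> module

theorem reversal_comp_self (E : Type*) [AddCommGroup E] [Module ℝ E] (a : ℝ) :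
    reversal E a ∘ₗ reversal E a = LinearMap.id := by
  refine LinearMap.ext fun z => ?_
  ext <;> simp [reversal] <;> module

theorem measurePreserving_of_comp_self_eq_id {E : Type*} [NormedAddCommGroup E] [NormedSpace ℝ E]
    [MeasurableSpace E] [BorelSpace E] [FiniteDimensional ℝ E] (μ : Measure E)
    [μ.IsAddHaarMeasure] {f : E →ₗ[ℝ] E} (hf : f ∘ₗ f = LinearMap.id) :
    MeasurePreserving f μ μ := by
  have hdet : LinearMap.det f * LinearMap.det f = 1 := by
    rw [← LinearMap.det_comp, hf, LinearMap.det_id]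
  have hne : LinearMap.det f ≠ 0 := fun h => by simp [h] at hdet
  have habs : |LinearMap.det f| = 1 := by
    rw [← sq_eq_sq₀ (abs_nonneg _) zero_le_one, sq_abs, sq, hdet, one_pow]
  refine ⟨f.continuous_of_finiteDimensional.measurable, ?_⟩
  rw [Measure.map_linearMap_addHaar_eq_smul_addHaar μ hne, abs_inv, habs]
  simp

/-- A linear involution has determinant ±1, so it preserves Lebesgue measure; this one also
preserves the quadratic form (1 - a²)‖x‖² + ‖y‖², to which the exponent of the product density is
proportional. -/
theorem measurePreserving_reversal {c a : ℝ} (hc : 0 < c) (ha : a ^ 2 < 1) :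
    MeasurePreserving (reversal (EuclideanSpace ℝ (Fin 2)) a)
      ((isoGaussian c).prod (isoGaussian ((1 - a ^ 2) * c)))
      ((isoGaussian c).prod (isoGaussian ((1 - a ^ 2) * c))) := by
  have ha' : 1 - a ^ 2 ≠ 0 := by linarith
  have hm := measurable_ofReal_isoDensity c
  have hm' := measurable_ofReal_isoDensity ((1 - a ^ 2) * c)
  rw [isoGaussian, isoGaussian, prod_withDensity hm hm']
  refine measurePreserving_withDensity
    (measurePreserving_of_comp_self_eq_id _ (reversal_comp_self _ a))
    ((hm.comp measurable_fst).mul (hm'.comp measurable_snd)) fun z => ?_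
  obtain ⟨x, y⟩ := z
  have h1 : 0 < 1 - a ^ 2 := by linarith
  have hpi := Real.pi_pos
  have hpos : ∀ (b : ℝ) (x), 0 < b → 0 ≤ isoDensity b x := fun b x hb => by
    unfold isoDensity; positivity
  rw [← ENNReal.ofReal_mul (hpos _ _ hc), ← ENNReal.ofReal_mul (hpos _ _ hc)]
  congr 1
  simp only [isoDensity, reversal, LinearMap.coe_mk, AddHom.coe_mk]
  rw [mul_mul_mul_comm, mul_mul_mul_comm _ _ _ (Real.exp (_ * ‖y‖ ^ 2)), ← Real.exp_add,
    ← Real.exp_add]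
  congr 2
  have e1 : ‖a • x - y‖ ^ 2 = a ^ 2 * ‖x‖ ^ 2 - 2 * a * inner ℝ x y + ‖y‖ ^ 2 := by
    rw [norm_sub_sq_real, norm_smul, inner_smul_left, mul_pow, Real.norm_eq_abs, sq_abs]
    simp; ring
  have e2 : ‖-((1 - a ^ 2) • x) - a • y‖ ^ 2 =
      (1 - a ^ 2) ^ 2 * ‖x‖ ^ 2 + 2 * a * (1 - a ^ 2) * inner ℝ x y + a ^ 2 * ‖y‖ ^ 2 := by
    rw [norm_sub_sq_real, norm_neg, norm_smul, norm_smul, inner_neg_left, inner_smul_left,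
      inner_smul_right, mul_pow, mul_pow, Real.norm_eq_abs, Real.norm_eq_abs, sq_abs, sq_abs]
    simp; ring
  rw [e1, e2]
  field_simp
  ring

end Gaussian

/-! ### Covariances, flow and semigroup of the example -/

section Example

open Matrix

theorem commute_exampleB (s : ℝ) : Commute (s • exampleB) (s • exampleB.transpose) := by
  refine Commute.smul_left (Commute.smul_right ?_ s) s
  ext i j
  fin_cases i <;> fin_cases j <;> simp [exampleB, Matrix.mul_apply, Fin.sum_univ_two]

/-- B is normal and B + Bᵀ = -2I. This is what makes all the covariances scalar. -/
theorem exp_exampleB_mul_exp_transpose (s : ℝ) :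
    NormedSpace.exp (s • exampleB) * NormedSpace.exp (s • exampleB.transpose) =
      Real.exp (-2 * s) • (1 : Matrix (Fin 2) (Fin 2) ℝ) := by
  rw [← Matrix.exp_add_of_commute _ _ (commute_exampleB s)]
  have : s • exampleB + s • exampleB.transpose = Matrix.diagonal (fun _ : Fin 2 => -2 * s) := by
    ext i j
    fin_cases i <;> fin_cases j <;> simp [exampleB] <;> ring
  rw [this, Matrix.exp_diagonal, Real.exp_eq_exp_ℝ]
  ext i j
  rw [Matrix.diagonal_apply, Matrix.smul_apply, Matrix.one_apply]
  split_ifs <;> simp [Pi.coe_exp]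

theorem covMatrix_eq {t : EReal} {c : ℝ}
    (hc : ∫ s in {s : ℝ | 0 < s ∧ (s : EReal) ≤ t}, Real.exp (-2 * s) = c) :
    covMatrix 1 exampleB t = c • (1 : Matrix (Fin 2) (Fin 2) ℝ) := by
  ext i j
  simp only [covMatrix, Matrix.of_apply, mul_one, exp_exampleB_mul_exp_transpose,
    Matrix.smul_apply, smul_eq_mul]
  rw [integral_mul_const, hc]

theorem gaussian_eq_isoGaussian {t : EReal} {c : ℝ} (hc : 0 < c)
    (h : covMatrix 1 exampleB t = c • (1 : Matrix (Fin 2) (Fin 2) ℝ)) :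
    gaussian 1 exampleB t = isoGaussian c := by
  have hpi := Real.pi_pos
  have hinv : (c • (1 : Matrix (Fin 2) (Fin 2) ℝ))⁻¹ = c⁻¹ • 1 :=
    Matrix.inv_eq_left_inv (by simp [smul_smul, hc.ne'])
  rw [gaussian, isoGaussian, h, hinv]
  congr 1
  funext x
  congr 1
  rw [isoDensity]
  congr 1
  · rw [Matrix.det_smul, Matrix.det_one, Fintype.card_fin, mul_one]
    rw [show -((2 : ℕ) : ℝ) / 2 = -1 by norm_num, Real.rpow_neg_one, neg_div,
      Real.rpow_neg (sq_nonneg c), ← Real.sqrt_eq_rpow, Real.sqrt_sq hc.le, ← mul_inv]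
  · congr 1
    rw [map_smul, map_one]
    simp [inner_smul_left]
    ring

theorem gaussianInfty_eq : gaussianInfty 1 exampleB = isoGaussian (1 / 2) := by
  refine gaussian_eq_isoGaussian (by norm_num) (covMatrix_eq ?_)
  have : {s : ℝ | 0 < s ∧ (s : EReal) ≤ ⊤} = Set.Ioi 0 := by ext; simp
  rw [this, integral_exp_mul_Ioi (by norm_num)]
  norm_num

/-- The variance ∫₀ᵗ e^{-2s} ds is written to fit `measurePreserving_reversal` with a = e^{-t} and c
= 1/2. -/
theorem gaussian_coe_eq {t : ℝ} (ht : 0 < t) :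
    gaussian 1 exampleB (t : EReal) = isoGaussian ((1 - Real.exp (-t) ^ 2) * (1 / 2)) := by
  have hlt : Real.exp (-t) ^ 2 < 1 := by
    rw [← Real.exp_nat_mul]; exact Real.exp_lt_one_iff.mpr (by push_cast; linarith)
  refine gaussian_eq_isoGaussian (by linarith) (covMatrix_eq ?_)
  have : {s : ℝ | 0 < s ∧ (s : EReal) ≤ t} = Set.Ioc 0 t := by ext; simp
  rw [this, ← intervalIntegral.integral_of_le ht.le,
    intervalIntegral.integral_comp_mul_left (fun x => Real.exp x) (by norm_num : (-2 : ℝ) ≠ 0),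
    integral_exp, ← Real.exp_nat_mul]
  simp
  ring

/-- The flow `exp (tB)` is a multiple of a linear isometry. -/
theorem exists_linearIsometryEquiv_exp (t : ℝ) :
    ∃ R : EuclideanSpace ℝ (Fin 2) ≃ₗᵢ[ℝ] EuclideanSpace ℝ (Fin 2), ∀ x,
      Matrix.toEuclideanCLM (𝕜 := ℝ) (NormedSpace.exp (t • exampleB)) x =
        Real.exp (-t) • R x := by
  set M := NormedSpace.exp (t • exampleB) with hM
  set L := Matrix.toEuclideanCLM (𝕜 := ℝ) M with hL
  have hadj : ContinuousLinearMap.adjoint L ∘L L = Real.exp (-2 * t) • 1 := by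
    have h1 : star M = NormedSpace.exp (t • exampleB.transpose) := by
      rw [hM, ← Matrix.transpose_smul, Matrix.exp_transpose, Matrix.star_eq_conjTranspose,
        Matrix.conjTranspose_eq_transpose_of_trivial]
    have h2 : star M * M = Real.exp (-2 * t) • 1 := by
      rw [h1, hM, ← exp_exampleB_mul_exp_transpose,
        ← Matrix.exp_add_of_commute _ _ (commute_exampleB t),
        ← Matrix.exp_add_of_commute _ _ (commute_exampleB t).symm, add_comm]
    have h3 := congrArg (Matrix.toEuclideanCLM (𝕜 := ℝ)) h2
    rw [map_mul, map_star, map_smul, map_one] at h3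
    exact h3
  have hnorm : ∀ x, ‖Real.exp t • L x‖ = ‖x‖ := by
    intro x
    rw [← sq_eq_sq₀ (norm_nonneg _) (norm_nonneg _), norm_smul, mul_pow, Real.norm_eq_abs, sq_abs,
      ← real_inner_self_eq_norm_sq (L x), ← ContinuousLinearMap.adjoint_inner_left,
      ← ContinuousLinearMap.comp_apply, hadj, _root_.smul_apply,
      one_apply_eq_self, inner_smul_left, real_inner_self_eq_norm_sq,
      ← Real.exp_nat_mul, ← mul_assoc]
    simp [← Real.exp_add]
  let R : EuclideanSpace ℝ (Fin 2) →ₗᵢ[ℝ] EuclideanSpace ℝ (Fin 2) :=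
    ⟨Real.exp t • (L : EuclideanSpace ℝ (Fin 2) →ₗ[ℝ] EuclideanSpace ℝ (Fin 2)), hnorm⟩
  refine ⟨R.toLinearIsometryEquiv rfl, fun x => ?_⟩
  change L x = Real.exp (-t) • (Real.exp t • L x)
  rw [smul_smul, ← Real.exp_add]
  simp

instance : IsProbabilityMeasure (gaussianInfty 1 exampleB) := by
  rw [gaussianInfty_eq]
  exact isProbabilityMeasure_isoGaussian (by norm_num)

/-- With a = e^{-t}, the first component of the reversal at (R x, y) is e^{-t} R x - y = e^{tB} x -
y, the argument in Kolmogorov's formula. Both Gaussians are rotation invariant, and the reversal has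
scalar coefficients, so it commutes with R × R. -/
theorem exists_isStarNormal_semigroup {t : ℝ} (ht : 0 < t) :
    ∃ T : L2 1 exampleB →L[ℂ] L2 1 exampleB, IsStarNormal T ∧
      ∀ u : L2 1 exampleB, T u =ᵐ[gaussianInfty 1 exampleB] semigroup 1 exampleB t u := by
  set a := Real.exp (-t) with ha
  have ha1 : a ^ 2 < 1 := by
    rw [ha, ← Real.exp_nat_mul]; exact Real.exp_lt_one_iff.mpr (by push_cast; linarith)
  obtain ⟨R, hR⟩ := exists_linearIsometryEquiv_exp t
  have hγ := gaussian_coe_eq ht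
  have : IsProbabilityMeasure (gaussian 1 exampleB (t : EReal)) := by
    rw [hγ]; exact isProbabilityMeasure_isoGaussian (by linarith)
  have hφ := measurePreserving_reversal (c := 1 / 2) (by norm_num) ha1
  have hid : R ∘ R.symm = id := by ext1 x; simp
  have hid' : R.symm ∘ R = id := by ext1 x; simp
  obtain ⟨T, hT, hTu⟩ := exists_isStarNormal_markov (μ := gaussianInfty 1 exampleB)
    (ν := gaussian 1 exampleB (t : EReal)) (φ := reversal _ a)
    (by rw [gaussianInfty_eq, hγ]; exact hφ)
    (by rw [← LinearMap.coe_comp, reversal_comp_self]; rfl)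
    (R := R) (R' := R.symm) (P := R) (P' := R.symm)
    (by rw [gaussianInfty_eq]; exact measurePreserving_isoGaussian _ _)
    (by rw [gaussianInfty_eq]; exact measurePreserving_isoGaussian _ _) hid hid'
    (by rw [hγ]; exact measurePreserving_isoGaussian _ _)
    (by rw [hγ]; exact measurePreserving_isoGaussian _ _) hid
    (by ext1 z; simp [reversal])
  refine ⟨T, hT, fun u => (hTu u).trans (Eventually.of_forall fun x => ?_)⟩
  simp only [semigroup, hR]
  rfl

/-! ### The generator, its eigenfunctions, and the spectrum of the drift -/

open Classical in
/-- The semigroup as a family of bounded operators on `L²(γ_∞)` (zero for nonpositive times). -/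
noncomputable def semigroupCLM (t : ℝ) : L2 1 exampleB →L[ℂ] L2 1 exampleB :=
  if ht : 0 < t then (exists_isStarNormal_semigroup ht).choose else 0

theorem isStarNormal_semigroupCLM {t : ℝ} (ht : 0 < t) : IsStarNormal (semigroupCLM t) := by
  rw [semigroupCLM, dif_pos ht]
  exact (exists_isStarNormal_semigroup ht).choose_spec.1

theorem semigroupCLM_coeFn {t : ℝ} (ht : 0 < t) (u : L2 1 exampleB) :
    semigroupCLM t u =ᵐ[gaussianInfty 1 exampleB] semigroup 1 exampleB t u := by
  rw [semigroupCLM, dif_pos ht]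
  exact (exists_isStarNormal_semigroup ht).choose_spec.2 u

theorem isGenerator_iff {u v : L2 1 exampleB} :
    IsGenerator 1 exampleB u v ↔
      Tendsto (fun t : ℝ => (t : ℂ)⁻¹ • (semigroupCLM t u - u)) (𝓝[>] 0) (𝓝 v) := by
  rw [tendsto_iff_edist_tendsto_0, IsGenerator]
  refine tendsto_congr' ?_
  filter_upwards [self_mem_nhdsWithin] with t ht
  rw [Lp.edist_def]
  refine eLpNorm_congr_ae ?_
  filter_upwards [semigroupCLM_coeFn ht u, Lp.coeFn_sub (semigroupCLM t u) u,
    Lp.coeFn_smul ((t : ℂ)⁻¹) (semigroupCLM t u - u)] with x h1 h2 h3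
  simp only [h3, h2, Pi.sub_apply, Pi.smul_apply, smul_eq_mul, h1]

theorem inner_isGenerator_eq {μ : ℂ} {u v w : L2 1 exampleB}
    (hv : IsGenerator 1 exampleB v (μ • v)) (hu : IsGenerator 1 exampleB u w) :
    inner ℂ v w = μ * inner ℂ v u :=
  inner_generator_eq (fun _ => isStarNormal_semigroupCLM) (isGenerator_iff.mp hv)
    (isGenerator_iff.mp hu)

theorem isGenerator_of_isShiftPow {μ : ℂ} (k : ℕ) (u : L2 1 exampleB)
    (h : IsShiftPow 1 exampleB μ (k + 1) u 0) : IsGenerator 1 exampleB u (μ • u) := by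
  induction k generalizing u with
  | zero =>
    obtain ⟨v, hv, h0⟩ := h
    rwa [sub_eq_zero.mp (Eq.symm h0)] at hv
  | succ k ih =>
    obtain ⟨v, hv, h0⟩ := h
    -- By induction `v - μ • u` satisfies the eigenvalue equation; pairing it with `v`, the image of
    -- `u`, shows that it is orthogonal to itself.
    have hw := inner_isGenerator_eq (ih _ h0) hv
    have h1 : inner ℂ (v - μ • u) (v - μ • u) = (0 : ℂ) := by
      rw [inner_sub_right _ v, hw, inner_smul_right, sub_self]
    rwa [sub_eq_zero.mp (inner_self_eq_zero.mp h1)] at hv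

theorem spectrum_exampleB :
    spectrum ℂ (exampleB.map (fun r : ℝ => (r : ℂ))) = {-1 + Complex.I, -1 - Complex.I} := by
  ext z
  rw [spectrum.mem_iff, Matrix.isUnit_iff_isUnit_det, isUnit_iff_ne_zero, not_not,
    Matrix.det_fin_two]
  have : (algebraMap ℂ (Matrix (Fin 2) (Fin 2) ℂ)) z = Matrix.diagonal fun _ => z := rfl
  simp only [this, exampleB, Matrix.sub_apply, Matrix.map_apply]
  simp only [Matrix.diagonal_apply, Matrix.of_apply, Matrix.cons_val', Matrix.cons_val_zero,
    Matrix.cons_val_one, Set.mem_insert_iff, Set.mem_singleton_iff]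
  have hI := Complex.I_mul_I
  -- The characteristic polynomial (z + 1)² + 1 is matched with the product of its linear factors,
  -- using i² = -1.
  rw [← sub_eq_zero (a := z), ← sub_eq_zero (a := z) (b := -1 - Complex.I), ← mul_eq_zero]
  refine Eq.congr_left ?_
  simp
  linear_combination hI

end Example

end OrnsteinUhlenbeck

theorem mainTheorem2 :
    spectrum ℂ (OrnsteinUhlenbeck.exampleB.map (fun r : ℝ => (r : ℂ))) =
        {-1 + Complex.I, -1 - Complex.I} ∧
      (∀ (μ : ℂ) (u : OrnsteinUhlenbeck.L2 1 OrnsteinUhlenbeck.exampleB),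
        OrnsteinUhlenbeck.IsGeneralizedEigenfunction 1 OrnsteinUhlenbeck.exampleB μ u →
          OrnsteinUhlenbeck.IsEigenfunction 1 OrnsteinUhlenbeck.exampleB μ u) ∧
      (∀ (μ ν : ℂ) (u v : OrnsteinUhlenbeck.L2 1 OrnsteinUhlenbeck.exampleB),
        μ ≠ ν →
          OrnsteinUhlenbeck.IsEigenfunction 1 OrnsteinUhlenbeck.exampleB μ u →
            OrnsteinUhlenbeck.IsEigenfunction 1 OrnsteinUhlenbeck.exampleB ν v →
              inner ℂ u v = 0) := by
  refine ⟨OrnsteinUhlenbeck.spectrum_exampleB, ?_, ?_⟩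
  · rintro μ u ⟨hu, k, hk, h⟩
    obtain ⟨k, rfl⟩ := Nat.exists_eq_succ_of_ne_zero hk.ne'
    exact ⟨hu, OrnsteinUhlenbeck.isGenerator_of_isShiftPow k u h⟩
  · rintro μ ν u v hμν ⟨-, hu⟩ ⟨-, hv⟩
    have h := OrnsteinUhlenbeck.inner_isGenerator_eq hu hv
    rw [inner_smul_right] at h
    have h0 : (ν - μ) * inner ℂ u v = 0 := by rw [sub_mul, h, sub_self]
    exact (mul_eq_zero.mp h0).resolve_left (sub_ne_zero.mpr hμν.symm)
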